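/- **Theorem (First Fundamental Theorem).** Let $h\in\mathbb C$, $h\neq 0$, and let $I$ be a totally ordered index set. Let $H_I$ be the complex unital associative algebra with generators $x_i,y_i$ $(i\in I)$ and relations $$x_iy_i=y_ix_i+h\,y_i^2\qquad(i\in I),$$ and, for $i<j$, $$x_jy_i=y_ix_j+h\,y_iy_j,\quad y_jx_i=x_iy_j-h\,y_iy_j,\quad y_jy_i=y_iy_j,\quad x_jx_i=x_ix_j-h\,x_iy_j+h\,y_ix_j+h^2\,y_iy_j.$$ Let $E,F,H$ be the linear operators on $H_I$ by which the generators of the quantum group $U_h(sl(2))$ act; they are the unique linear operators with $$Ex_i=0,\ Ey_i=x_i,\quad Fx_i=y_i,\ Fy_i=0,\quad Hx_i=x_i,\ Hy_i=-y_i,\quad E1=F1=H1=0,$$ and, for all $a,b\in H_I$, $$E(ab)=E(a)\,e^{-hF}(b)+e^{hF}(a)\,E(b),\quad F(ab)=F(a)\,b+a\,F(b),\quad H(ab)=H(a)\,e^{-hF}(b)+e^{hF}(a)\,H(b),$$ where $e^{tF}(a)=\sum_{n\ge 0}\frac{t^n}{n!}F^n(a)$, a sum with only finitely many nonzero terms.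 Let $H_I^{Inv}=\{v\in H_I: E(v)=F(v)=H(v)=0\}$, which is a subalgebra of $H_I$, and let $S_I\subseteq H_I$ be the unital subalgebra generated by the bracket symbols $$(ij)=x_iy_j-y_ix_j-h\,y_iy_j\qquad(i,j\in I).$$ Then $H_I^{Inv}=S_I$. -/

import Mathlib

/-- Generators of the algebra `H_I`: two symbols `x_i`, `y_i` for every index `i`. -/
inductive HGen (I : Type*) : Type _
  | x (i : I)
  | y (i : I)

namespace HAlg

noncomputable section

/-- The elements `X i`, `Y i` of a complex algebra satisfy the defining relations of `H_I`. -/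
structure Compat {I : Type*} [LinearOrder I] (h : ℂ) {B : Type*} [Ring B] [Algebra ℂ B]
    (X Y : I → B) : Prop where
  xy (i : I) : X i * Y i = Y i * X i + h • (Y i * Y i)
  xy_lt {i j : I} : i < j → X j * Y i = Y i * X j + h • (Y i * Y j)
  yx_lt {i j : I} : i < j → Y j * X i = X i * Y j - h • (Y i * Y j)
  yy_lt {i j : I} : i < j → Y j * Y i = Y i * Y j
  xx_lt {i j : I} : i < j →
    X j * X i = X i * X j - h • (X i * Y j) + h • (Y i * X j) + h ^ 2 • (Y i * Y j)

section defs

variable (I : Type*) [LinearOrder I] (h : ℂ)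

/-- The free algebra generator `x_i`. -/
def fx {I : Type*} (i : I) : FreeAlgebra ℂ (HGen I) := FreeAlgebra.ι ℂ (HGen.x i)

/-- The free algebra generator `y_i`. -/
def fy {I : Type*} (i : I) : FreeAlgebra ℂ (HGen I) := FreeAlgebra.ι ℂ (HGen.y i)

/-- The defining relations of `H_I`. -/
inductive Rel : FreeAlgebra ℂ (HGen I) → FreeAlgebra ℂ (HGen I) → Prop
  | xy (i : I) : Rel (fx i * fy i) (fy i * fx i + h • (fy i * fy i))
  | xy_lt (i j : I) : i < j → Rel (fx j * fy i) (fy i * fx j + h • (fy i * fy j))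
  | yx_lt (i j : I) : i < j → Rel (fy j * fx i) (fx i * fy j - h • (fy i * fy j))
  | yy_lt (i j : I) : i < j → Rel (fy j * fy i) (fy i * fy j)
  | xx_lt (i j : I) : i < j → Rel (fx j * fx i)
      (fx i * fx j - h • (fx i * fy j) + h • (fy i * fx j) + h ^ 2 • (fy i * fy j))

end defs

end

end HAlg

/-- The algebra `H_I`: the complex unital algebra with generators `x_i, y_i`, `i ∈ I`, modulo the
defining relations. -/
abbrev HAlg (I : Type*) [LinearOrder I] (h : ℂ) : Type _ := RingQuot (HAlg.Rel I h)

namespace HAlg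

noncomputable section

section

variable {I : Type*} [LinearOrder I] (h : ℂ)

/-- The generator `x_i` of `H_I`. -/
def x (i : I) : HAlg I h := RingQuot.mkAlgHom ℂ (Rel I h) (fx i)

/-- The generator `y_i` of `H_I`. -/
def y (i : I) : HAlg I h := RingQuot.mkAlgHom ℂ (Rel I h) (fy i)

theorem compat : Compat h (x (I := I) h) (y h) where
  xy i := by
    simpa [x, y] using RingQuot.mkAlgHom_rel ℂ (Rel.xy (h := h) i)
  xy_lt hij := by
    simpa [x, y] using RingQuot.mkAlgHom_rel ℂ (Rel.xy_lt (h := h) _ _ hij)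
  yx_lt hij := by
    simpa [x, y] using RingQuot.mkAlgHom_rel ℂ (Rel.yx_lt (h := h) _ _ hij)
  yy_lt hij := by
    simpa [x, y] using RingQuot.mkAlgHom_rel ℂ (Rel.yy_lt (h := h) _ _ hij)
  xx_lt hij := by
    simpa [x, y] using RingQuot.mkAlgHom_rel ℂ (Rel.xx_lt (h := h) _ _ hij)

variable {h}

/-- The universal property of `H_I`. -/
def lift {B : Type*} [Ring B] [Algebra ℂ B] {X Y : I → B} (hc : Compat h X Y) :
    HAlg I h →ₐ[ℂ] B :=
  RingQuot.liftAlgHom ℂ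
    ⟨FreeAlgebra.lift ℂ (fun g : HGen I => match g with
      | .x i => X i
      | .y i => Y i), by
      intro a b hab
      cases hab with
      | xy i => simpa [fx, fy] using hc.xy i
      | xy_lt i j hij => simpa [fx, fy] using hc.xy_lt hij
      | yx_lt i j hij => simpa [fx, fy] using hc.yx_lt hij
      | yy_lt i j hij => simpa [fx, fy] using hc.yy_lt hij
      | xx_lt i j hij => simpa [fx, fy] using hc.xx_lt hij⟩

@[simp] theorem lift_x {B : Type*} [Ring B] [Algebra ℂ B] {X Y : I → B} (hc : Compat h X Y)
    (i : I) : lift hc (x h i) = X i := by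
  simp [lift, x, fx]

@[simp] theorem lift_y {B : Type*} [Ring B] [Algebra ℂ B] {X Y : I → B} (hc : Compat h X Y)
    (i : I) : lift hc (y h i) = Y i := by
  simp [lift, y, fy]

theorem induction {P : HAlg I h → Prop} (hx : ∀ i, P (x h i)) (hy : ∀ i, P (y h i))
    (hs : ∀ c : ℂ, P (algebraMap ℂ _ c)) (ha : ∀ a b, P a → P b → P (a + b))
    (hm : ∀ a b, P a → P b → P (a * b)) (a : HAlg I h) : P a := by
  obtain ⟨a, rfl⟩ := RingQuot.mkAlgHom_surjective ℂ (Rel I h) a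
  induction a using FreeAlgebra.induction with
  | grade0 c => simpa using hs c
  | grade1 g =>
    cases g with
    | x i => exact hx i
    | y i => exact hy i
  | mul a b h1 h2 => simpa using hm _ _ h1 h2
  | add a b h1 h2 => simpa using ha _ _ h1 h2

theorem compat_F : Compat h (I := I)
    (fun i => !![x h i, y h i; 0, x h i]) (fun i => !![y h i, 0; 0, y h i]) := by
  have hc := compat (I := I) h
  constructor
  · intro i
    ext a b
    fin_cases a <;> fin_cases b <;> simp [Matrix.mul_apply, hc.xy]
  all_goals
    intro i j hij
    ext a b
    fin_cases a <;> fin_cases b <;>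
    simp [Matrix.mul_apply, hc.xy_lt hij, hc.yx_lt hij, hc.yy_lt hij, hc.xx_lt hij] <;> module

theorem compat_EH (e c : ℂ) : Compat h (I := I)
    (fun i => !![x h i + h • y h i, c • x h i; 0, x h i - h • y h i])
    (fun i => !![y h i, e • x h i - c • y h i; 0, y h i]) := by
  have hc := compat (I := I) h
  constructor
  · intro i
    ext a b
    fin_cases a <;> fin_cases b <;>
    simp only [Matrix.mul_apply, Fin.sum_univ_two, Matrix.of_apply, Matrix.cons_val',
      Matrix.add_apply, Matrix.smul_apply] <;>
    try simp only [Matrix.cons_val, Fin.zero_eta, Fin.mk_one, mul_zero, zero_mul,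
      add_zero, zero_add, smul_zero] <;>
    try simp only [mul_add, add_mul, mul_sub, sub_mul, smul_mul_assoc, mul_smul_comm, hc.xy] <;> module
  all_goals
    intro i j hij
    ext a b
    fin_cases a <;> fin_cases b <;>
    simp only [Matrix.mul_apply, Fin.sum_univ_two, Matrix.of_apply, Matrix.cons_val',
      Matrix.add_apply, Matrix.sub_apply, Matrix.smul_apply] <;>
    try simp only [Matrix.cons_val, Fin.zero_eta, Fin.mk_one, mul_zero, zero_mul,
      add_zero, zero_add, sub_zero, smul_zero] <;>
    try simp only [mul_add, add_mul, mul_sub, sub_mul, smul_mul_assoc, mul_smul_comm,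
      hc.xy_lt hij, hc.yx_lt hij, hc.yy_lt hij, hc.xx_lt hij] <;> module

theorem compat_E : Compat h (I := I)
    (fun i => !![x h i + h • y h i, 0; 0, x h i - h • y h i])
    (fun i => !![y h i, x h i; 0, y h i]) := by
  simpa using compat_EH (I := I) (h := h) 1 0

theorem compat_H : Compat h (I := I)
    (fun i => !![x h i + h • y h i, x h i; 0, x h i - h • y h i])
    (fun i => !![y h i, -y h i; 0, y h i]) := by
  simpa using compat_EH (I := I) (h := h) 0 1

theorem compat_sigma (t : ℂ) : Compat h (fun i : I => x h i + t • y h i) (y h) := by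
  have hc := compat (I := I) h
  constructor
  · intro i
    simp only [mul_add, add_mul, smul_mul_assoc, mul_smul_comm, hc.xy]
    module
  all_goals
    intro i j hij
    simp only [mul_add, add_mul, smul_mul_assoc, mul_smul_comm,
      hc.xy_lt hij, hc.yx_lt hij, hc.yy_lt hij, hc.xx_lt hij]
  all_goals module

open Polynomial in
theorem compat_poly : Compat h (fun i : I => monomial 0 (x h i) + monomial 1 (y h i))
    (fun i => monomial 0 (y h i)) := by
  have hc := compat (I := I) h
  constructor
  · intro i
    simp only [mul_add, add_mul, monomial_mul_monomial, hc.xy, map_add, ← smul_monomial]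
    module
  · intro i j hij
    simp only [mul_add, add_mul, monomial_mul_monomial, hc.xy_lt hij, hc.yy_lt hij, map_add,
      ← smul_monomial]
    module
  · intro i j hij
    simp only [mul_add, add_mul, monomial_mul_monomial, hc.yx_lt hij, hc.yy_lt hij, map_sub,
      ← smul_monomial]
    module
  · intro i j hij
    simp only [monomial_mul_monomial, hc.yy_lt hij]
  · intro i j hij
    simp only [mul_add, add_mul, monomial_mul_monomial, hc.xy_lt hij, hc.yx_lt hij, hc.yy_lt hij,
      hc.xx_lt hij, map_add, map_sub, ← smul_monomial, zero_add, add_zero]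
    module

/-- The operator `F` on `H_I`: the upper right entry of the representation
`a ↦ !![a, F a; 0, a]`. -/
def F : HAlg I h →ₗ[ℂ] HAlg I h :=
  Matrix.entryLinearMap ℂ (HAlg I h) (0 : Fin 2) (1 : Fin 2) ∘ₗ (lift compat_F).toLinearMap

/-- The operator `E` on `H_I`: the upper right entry of the representation
`a ↦ !![exp(hF) a, E a; 0, exp(-hF) a]`. -/
def E : HAlg I h →ₗ[ℂ] HAlg I h :=
  Matrix.entryLinearMap ℂ (HAlg I h) (0 : Fin 2) (1 : Fin 2) ∘ₗ (lift compat_E).toLinearMap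

/-- The operator `H` on `H_I`: the upper right entry of the representation
`a ↦ !![exp(hF) a, H a; 0, exp(-hF) a]`. -/
def H : HAlg I h →ₗ[ℂ] HAlg I h :=
  Matrix.entryLinearMap ℂ (HAlg I h) (0 : Fin 2) (1 : Fin 2) ∘ₗ (lift compat_H).toLinearMap

/-- `exp(tF) a = ∑ₙ tⁿ/n! Fⁿ a`; only finitely many terms are nonzero. -/
def expF (t : ℂ) (a : HAlg I h) : HAlg I h :=
  ∑ᶠ n : ℕ, (t ^ n / (n.factorial : ℂ)) • (F ^ n) a

theorem lift_F (a : HAlg I h) : lift compat_F a = !![a, F a; 0, a] := by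
  have key : lift compat_F a 0 0 = a ∧ lift compat_F a 1 0 = 0 ∧ lift compat_F a 1 1 = a := by
    induction a using induction with
    | hx i => simp
    | hy i => simp
    | hs c => simp [Matrix.algebraMap_matrix_apply]
    | ha a b h1 h2 => simp [h1, h2]
    | hm a b h1 h2 => simp [Matrix.mul_apply, h1, h2]
  ext i j
  fin_cases i <;> fin_cases j <;> simp [key, F]

/-- The Leibniz rule for `F`. -/
theorem F_mul (a b : HAlg I h) : F (a * b) = F a * b + a * F b := by
  have := congrFun (congrFun (map_mul (lift compat_F) a b) 0) 1
  simpa [lift_F, Matrix.mul_apply, add_comm] using this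

theorem F_algebraMap (c : ℂ) : F (algebraMap ℂ (HAlg I h) c) = 0 := by
  simp [F, Matrix.algebraMap_matrix_apply]

@[simp] theorem F_one : F (1 : HAlg I h) = 0 := by simpa using F_algebraMap (I := I) (h := h) 1

@[simp] theorem F_x (i : I) : F (x h i) = y h i := by simp [F]

@[simp] theorem F_y (i : I) : F (y h i) = 0 := by simp [F]

/-- The algebra homomorphism `a ↦ ∑ₙ (Fⁿ a / n!) Xⁿ`. -/
def polyExp : HAlg I h →ₐ[ℂ] Polynomial (HAlg I h) := lift compat_poly

theorem derivative_polyExp (a : HAlg I h) :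
    Polynomial.derivative (polyExp a) = polyExp (F a) := by
  induction a using induction with
  | hx i => simp [polyExp]
  | hy i => simp [polyExp]
  | hs c =>
    rw [F_algebraMap, AlgHom.commutes, map_zero, Polynomial.algebraMap_apply,
      Polynomial.derivative_C]
  | ha a b h1 h2 => simp [h1, h2]
  | hm a b h1 h2 => simp [Polynomial.derivative_mul, h1, h2, F_mul]

theorem coeff_zero_polyExp (a : HAlg I h) : (polyExp a).coeff 0 = a := by
  induction a using induction with
  | hx i => simp [polyExp]
  | hy i => simp [polyExp]
  | hs c => rw [AlgHom.commutes, Polynomial.algebraMap_apply, Polynomial.coeff_C_zero]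
  | ha a b h1 h2 => simp [h1, h2]
  | hm a b h1 h2 => simp [Polynomial.mul_coeff_zero, h1, h2]

theorem coeff_polyExp (a : HAlg I h) (n : ℕ) :
    (F ^ n) a = (n.factorial : ℂ) • (polyExp a).coeff n := by
  induction n generalizing a with
  | zero => simp [coeff_zero_polyExp]
  | succ n ih =>
    rw [pow_succ, Module.End.mul_apply, ih, ← derivative_polyExp, Polynomial.coeff_derivative,
      Nat.factorial_succ]
    have : (polyExp a).coeff (n + 1) * ((n : HAlg I h) + 1) =
        ((n : ℂ) + 1) • (polyExp a).coeff (n + 1) := by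
      rw [mul_add, add_smul, one_smul, mul_one, ← Nat.cast_comm, ← nsmul_eq_mul,
        Nat.cast_smul_eq_nsmul]
    rw [this, smul_smul]
    push_cast
    ring_nf

/-- `F` is locally nilpotent. -/
theorem exists_F_pow_eq_zero (a : HAlg I h) : ∃ N : ℕ, ∀ n ≥ N, (F ^ n) a = 0 := by
  refine ⟨(polyExp a).natDegree + 1, fun n hn => ?_⟩
  rw [coeff_polyExp, Polynomial.coeff_eq_zero_of_natDegree_lt (by omega), smul_zero]

/-- `exp(tF)` is the algebra homomorphism with `x_i ↦ x_i + t y_i` and `y_i ↦ y_i`. -/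
theorem expF_eq_lift (t : ℂ) (a : HAlg I h) : expF t a = lift (compat_sigma t) a := by
  have e1 : expF t a = ((polyExp a).eval (algebraMap ℂ (HAlg I h) t)) := by
    rw [expF, Polynomial.eval_eq_sum_range, finsum_eq_sum_of_support_subset]
    · refine Finset.sum_congr rfl fun n _ => ?_
      rw [coeff_polyExp, smul_smul, div_mul_cancel₀ _ (by exact_mod_cast n.factorial_ne_zero),
        ← map_pow, ← Algebra.commutes, ← Algebra.smul_def]
    · intro n hn
      by_contra hlt
      simp only [Finset.coe_range, Set.mem_Iio, not_lt] at hlt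
      refine hn ?_
      dsimp only
      rw [coeff_polyExp, Polynomial.coeff_eq_zero_of_natDegree_lt (by omega), smul_zero, smul_zero]
  rw [e1]
  clear e1
  have hcomm : ∀ b, Commute b (algebraMap ℂ (HAlg I h) t) := fun b => (Algebra.commutes t b).symm
  induction a using induction with
  | hx i => simp [polyExp, ← Algebra.commutes, ← Algebra.smul_def]
  | hy i => simp [polyExp]
  | hs c => rw [AlgHom.commutes, AlgHom.commutes, Polynomial.algebraMap_apply, Polynomial.eval_C]
  | ha a b h1 h2 =>
    rw [map_add, Polynomial.eval_add, h1, h2, map_add]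
  | hm a b h1 h2 =>
    rw [map_mul, Polynomial.eval, Polynomial.eval₂_mul_noncomm _ _ (fun k => hcomm _), map_mul]
    exact congrArg₂ (· * ·) h1 h2

theorem expF_mul (t : ℂ) (a b : HAlg I h) : expF t (a * b) = expF t a * expF t b := by
  simp [expF_eq_lift]

theorem expF_add (t : ℂ) (a b : HAlg I h) : expF t (a + b) = expF t a + expF t b := by
  simp [expF_eq_lift]

theorem expF_expF (s t : ℂ) (a : HAlg I h) : expF s (expF t a) = expF (s + t) a := by
  simp only [expF_eq_lift]
  induction a using induction with
  | hx i =>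
    simp only [lift_x, map_add, map_smul, lift_y]
    module
  | hy i => simp
  | hs c => simp
  | ha a b h1 h2 => simp only [map_add, h1, h2]
  | hm a b h1 h2 => simp only [map_mul, h1, h2]

theorem expF_zero (a : HAlg I h) : expF 0 a = a := by
  rw [expF, finsum_eq_single _ 0]
  · simp
  · intro n hn
    simp [hn]

theorem expF_comm (s t : ℂ) (a : HAlg I h) : expF s (expF t a) = expF t (expF s a) := by
  rw [expF_expF, expF_expF, add_comm]

theorem expF_h_neg (a : HAlg I h) : expF h (expF (-h) a) = a := by
  rw [expF_expF, add_neg_cancel, expF_zero]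

theorem expF_neg_h (a : HAlg I h) : expF (-h) (expF h a) = a := by
  rw [expF_expF, neg_add_cancel, expF_zero]

theorem expF_eq_self (t : ℂ) {a : HAlg I h} (ha : F a = 0) : expF t a = a := by
  rw [expF, finsum_eq_single _ 0]
  · simp
  · intro n hn
    obtain ⟨m, rfl⟩ := Nat.exists_eq_succ_of_ne_zero hn
    simp [pow_succ, ha]

theorem lift_E (a : HAlg I h) : lift compat_E a = !![expF h a, E a; 0, expF (-h) a] := by
  have key : lift compat_E a 0 0 = expF h a ∧ lift compat_E a 1 0 = 0 ∧
      lift compat_E a 1 1 = expF (-h) a := by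
    simp only [expF_eq_lift]
    induction a using induction with
    | hx i =>
      simp [sub_eq_add_neg]
      module
    | hy i => simp
    | hs c => simp [Matrix.algebraMap_matrix_apply]
    | ha a b h1 h2 => simp [h1, h2]
    | hm a b h1 h2 => simp [Matrix.mul_apply, h1, h2]
  ext i j
  fin_cases i <;> fin_cases j <;> simp [key, E]

/-- The twisted Leibniz rule for `E`. -/
theorem E_mul (a b : HAlg I h) : E (a * b) = E a * expF (-h) b + expF h a * E b := by
  have := congrFun (congrFun (map_mul (lift compat_E) a b) 0) 1
  simpa [lift_E, Matrix.mul_apply, add_comm] using this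

theorem E_algebraMap (c : ℂ) : E (algebraMap ℂ (HAlg I h) c) = 0 := by
  simp [E, Matrix.algebraMap_matrix_apply]

@[simp] theorem E_one : E (1 : HAlg I h) = 0 := by simpa using E_algebraMap (I := I) (h := h) 1

@[simp] theorem E_x (i : I) : E (x h i) = 0 := by simp [E]

@[simp] theorem E_y (i : I) : E (y h i) = x h i := by simp [E]

theorem lift_H (a : HAlg I h) : lift compat_H a = !![expF h a, H a; 0, expF (-h) a] := by
  have key : lift compat_H a 0 0 = expF h a ∧ lift compat_H a 1 0 = 0 ∧
      lift compat_H a 1 1 = expF (-h) a := by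
    simp only [expF_eq_lift]
    induction a using induction with
    | hx i =>
      simp [sub_eq_add_neg]
      module
    | hy i => simp
    | hs c => simp [Matrix.algebraMap_matrix_apply]
    | ha a b h1 h2 => simp [h1, h2]
    | hm a b h1 h2 => simp [Matrix.mul_apply, h1, h2]
  ext i j
  fin_cases i <;> fin_cases j <;> simp [key, H]

/-- The twisted Leibniz rule for `H`. -/
theorem H_mul (a b : HAlg I h) : H (a * b) = H a * expF (-h) b + expF h a * H b := by
  have := congrFun (congrFun (map_mul (lift compat_H) a b) 0) 1
  simpa [lift_H, Matrix.mul_apply, add_comm] using this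

theorem H_algebraMap (c : ℂ) : H (algebraMap ℂ (HAlg I h) c) = 0 := by
  simp [H, Matrix.algebraMap_matrix_apply]

@[simp] theorem H_one : H (1 : HAlg I h) = 0 := by simpa using H_algebraMap (I := I) (h := h) 1

@[simp] theorem H_x (i : I) : H (x h i) = x h i := by simp [H]

@[simp] theorem H_y (i : I) : H (y h i) = -y h i := by simp [H]

theorem F_expF (t : ℂ) (a : HAlg I h) : F (expF t a) = expF t (F a) := by
  induction a using induction with
  | hx i => simp [expF_eq_lift]
  | hy i => simp [expF_eq_lift]
  | hs c => simp [expF_eq_lift, F_algebraMap]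
  | ha a b h1 h2 => simp only [map_add, expF_add, h1, h2]
  | hm a b h1 h2 => simp only [F_mul, expF_add, expF_mul, h1, h2]

/-- The relation `[E, F] = H`. -/
theorem E_F_sub (a : HAlg I h) : E (F a) - F (E a) = H a := by
  induction a using induction with
  | hx i => simp
  | hy i => simp
  | hs c => simp [E_algebraMap, F_algebraMap, H_algebraMap]
  | ha a b h1 h2 => simp only [map_add, ← h1, ← h2]; abel
  | hm a b h1 h2 =>
    simp only [F_mul, E_mul, map_add, H_mul, F_expF, ← h1, ← h2, sub_mul, mul_sub]
    abel

/-- The relation `[H, F] = -(2/h) sinh(hF)`. -/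
theorem H_F_sub (hh : h ≠ 0) (a : HAlg I h) :
    H (F a) - F (H a) = (-(2 / h)) • ((1 / 2 : ℂ) • (expF h a - expF (-h) a)) := by
  induction a using induction with
  | hx i =>
    simp only [F_x, H_y, H_x, expF_eq_lift, lift_x]
    match_scalars <;> field_simp <;> ring
  | hy i => simp [expF_eq_lift]
  | hs c => simp [H_algebraMap, F_algebraMap, expF_eq_lift]
  | ha a b h1 h2 =>
    have : ∀ p q r s : HAlg I h, p + q - (r + s) = (p - r) + (q - s) := fun p q r s => by abel
    simp only [map_add, expF_add, this, h1, h2]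
    module
  | hm a b h1 h2 =>
    have : H (F (a * b)) - F (H (a * b)) =
        (H (F a) - F (H a)) * expF (-h) b + expF h a * (H (F b) - F (H b)) := by
      simp only [F_mul, H_mul, map_add, F_expF, sub_mul, mul_sub]
      abel
    rw [this, h1, h2]
    simp only [expF_mul, mul_smul_comm, smul_mul_assoc, mul_sub, sub_mul]
    module

theorem expF_E (hh : h ≠ 0) (t : ℂ) (a : HAlg I h) :
    expF t (E a) = E (expF t a) - t • H (expF t a)
      - (t ^ 2 / (2 * h)) • (expF h (expF t a) - expF (-h) (expF t a)) := by
  induction a using induction with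
  | hx i =>
    simp only [E_x, expF_eq_lift, lift_x, map_add, map_smul, E_y, H_x, H_y, lift_y, map_zero]
    match_scalars <;> field_simp <;> ring
  | hy i => simp [expF_eq_lift]
  | hs c => simp [E_algebraMap, H_algebraMap, expF_eq_lift]
  | ha a b h1 h2 =>
    simp only [map_add, expF_add, h1, h2]
    module
  | hm a b h1 h2 =>
    simp only [E_mul, H_mul, expF_add, expF_mul, h1, h2, expF_comm _ t, sub_mul, mul_sub,
      smul_mul_assoc, mul_smul_comm]
    module

theorem expF_H (hh : h ≠ 0) (t : ℂ) (a : HAlg I h) :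
    expF t (H a) = H (expF t a) + (t / h) • (expF h (expF t a) - expF (-h) (expF t a)) := by
  induction a using induction with
  | hx i =>
    simp only [expF_eq_lift, lift_x, map_add, map_smul, H_x, H_y, lift_y]
    match_scalars <;> field_simp <;> ring
  | hy i => simp [expF_eq_lift]
  | hs c => simp [H_algebraMap, expF_eq_lift]
  | ha a b h1 h2 =>
    simp only [map_add, expF_add, h1, h2]
    module
  | hm a b h1 h2 =>
    simp only [H_mul, expF_add, expF_mul, h1, h2, expF_comm _ t, sub_mul, mul_sub, add_mul, mul_add,
      smul_mul_assoc, mul_smul_comm]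
    module

/-- The relation `[H, E] = E cosh(hF) + cosh(hF) E`. -/
theorem H_E_sub (hh : h ≠ 0) (a : HAlg I h) :
    H (E a) - E (H a) = E ((1 / 2 : ℂ) • (expF h a + expF (-h) a))
      + (1 / 2 : ℂ) • (expF h (E a) + expF (-h) (E a)) := by
  induction a using induction with
  | hx i =>
    simp only [expF_eq_lift, lift_x, E_x, H_x, map_zero, map_add, map_smul, E_y]
    module
  | hy i =>
    simp only [expF_eq_lift, lift_x, lift_y, E_y, H_x, H_y, map_neg, map_add, map_smul]
    module
  | hs c => simp [H_algebraMap, E_algebraMap, expF_eq_lift]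
  | ha a b h1 h2 =>
    have : ∀ p q r s : HAlg I h, p + q - (r + s) = (p - r) + (q - s) := fun p q r s => by abel
    simp only [map_add, expF_add, this, h1, h2, map_smul]
    module
  | hm a b h1 h2 =>
    have : H (E (a * b)) - E (H (a * b)) =
        (H (E a) - E (H a)) * expF (-h) (expF (-h) b) +
        expF h (expF h a) * (H (E b) - E (H b)) +
        (expF h (E a) * H (expF (-h) b) - expF h (H a) * E (expF (-h) b)) +
        (H (expF h a) * expF (-h) (E b) - E (expF h a) * expF (-h) (H b)) := by
      simp only [E_mul, H_mul, map_add, sub_mul, mul_sub]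
      abel
    rw [this, h1, h2]
    simp only [E_mul, expF_mul, expF_add, map_add, map_smul, expF_E hh, expF_H hh, expF_h_neg,
      expF_neg_h, add_mul, mul_add, sub_mul, mul_sub, smul_mul_assoc, mul_smul_comm]
    match_scalars <;> field_simp <;> ring

variable (I h)

/-- The subalgebra of invariant elements: those killed by `E`, `F` and `H`. -/
def invariants : Subalgebra ℂ (HAlg I h) where
  carrier := {v | E v = 0 ∧ F v = 0 ∧ H v = 0}
  mul_mem' := by
    rintro a b ⟨ha, ha', ha''⟩ ⟨hb, hb', hb''⟩
    exact ⟨by simp [E_mul, ha, hb], by simp [F_mul, ha', hb'], by simp [H_mul, ha'', hb'']⟩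
  add_mem' := by
    rintro a b ⟨ha, ha', ha''⟩ ⟨hb, hb', hb''⟩
    exact ⟨by simp [ha, hb], by simp [ha', hb'], by simp [ha'', hb'']⟩
  algebraMap_mem' c := ⟨E_algebraMap c, F_algebraMap c, H_algebraMap c⟩

variable {I}

/-- The bracket symbol `(ij) = x_i y_j - y_i x_j - h y_i y_j`. -/
def bracket (i j : I) : HAlg I h := x h i * y h j - y h i * x h j - h • (y h i * y h j)

variable (I)

/-- The subalgebra `S_I` of `H_I` generated by all bracket symbols. -/
def bracketAlgebra : Subalgebra ℂ (HAlg I h) :=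
  Algebra.adjoin ℂ {s | ∃ i j : I, s = bracket h i j}

end

end

end HAlg

/-! Filter $H_I$ by the weight of words (number of $x$ minus number of $y$), with the length
bounded. Generators commute up to lower weight (`gen_mul_sub_mem_fil`) and $e^{tF}$ is the identity
up to weight two lower. To leading order the algebra is therefore commutative and $E,F,H$ are the
classical $sl(2)$ derivations: $F$ lowers weight by 2, $E$ raises it by 2, and $H$ is multiplication
by the weight. No basis of $H_I$ is needed, only spanning sets and this filtration.

Two facts carry the nontrivial inclusion. Straightening (`word_mem_straight`,
`fil_zero_le_straight`): every element of weight at most 0 is $s+F(d)+c$ with $s\in S_I$, $d$ of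
weight at most 2 and $c$ of negative weight. Injectivity (`mem_fil_one_of_E_F_mem`): $EF$ is
injective on the graded piece of weight 2.

An invariant $v$ has weight at most 0, since $H$ is invertible on the positive pieces. Write
$v=s+F(d)+c$. Then $r=F(d)+c$ is invariant too, so $EF(d)=-E(c)$ has weight at most 1. Injectivity
lowers $d$ to weight at most 1, hence $r$ has negative weight. As $Hr=0$ and $H$ is invertible on
negative pieces, $r=0$ and $v=s$. -/

namespace HAlg

noncomputable section

/-! ### Weights of words -/

/-- The weight of a generator: `1` for `x_i` and `-1` for `y_i`. -/
def genWeight {I : Type*} : HGen I → ℤ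
  | .x _ => 1
  | .y _ => -1

/-- The index of a generator. -/
def genIndex {I : Type*} : HGen I → I
  | .x i => i
  | .y i => i

/-- The weight of a word: the number of `x`'s minus the number of `y`'s. -/
def weight {I : Type*} (u : List (HGen I)) : ℤ := (u.map genWeight).sum

@[simp] theorem weight_nil {I : Type*} : weight ([] : List (HGen I)) = 0 := rfl

@[simp] theorem weight_cons {I : Type*} (g : HGen I) (u : List (HGen I)) :
    weight (g :: u) = genWeight g + weight u := by simp [weight]

@[simp] theorem weight_append {I : Type*} (u v : List (HGen I)) :
    weight (u ++ v) = weight u + weight v := by simp [weight]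

theorem weight_perm {I : Type*} {u v : List (HGen I)} (p : u.Perm v) : weight u = weight v :=
  (p.map genWeight).sum_eq

theorem neg_length_le_weight {I : Type*} (u : List (HGen I)) : -(u.length : ℤ) ≤ weight u := by
  induction u with
  | nil => simp
  | cons g u ih => cases g <;> simp [genWeight] <;> omega

theorem weight_le_length {I : Type*} (u : List (HGen I)) : weight u ≤ u.length := by
  induction u with
  | nil => simp
  | cons g u ih => cases g <;> simp [genWeight] <;> omega

/-- The minimal weight is attained only by words without any letter `x`. -/
theorem exists_perm_x_cons {I : Type*} {u : List (HGen I)} (hu : -(u.length : ℤ) < weight u) :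
    ∃ i v, u.Perm (.x i :: v) := by
  induction u with
  | nil => simp at hu
  | cons g u ih =>
    cases g with
    | x i => exact ⟨i, u, .refl _⟩
    | y j =>
      obtain ⟨i, v, p⟩ := ih (by simp [genWeight] at hu; omega)
      exact ⟨i, .y j :: v, (p.cons _).trans (.swap _ _ _)⟩

theorem exists_perm_y_cons {I : Type*} {u : List (HGen I)} (hu : weight u < u.length) :
    ∃ i v, u.Perm (.y i :: v) := by
  induction u with
  | nil => simp at hu
  | cons g u ih =>
    cases g with
    | y i => exact ⟨i, u, .refl _⟩
    | x j =>
      obtain ⟨i, v, p⟩ := ih (by simp [genWeight] at hu; omega)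
      exact ⟨i, .x j :: v, (p.cons _).trans (.swap _ _ _)⟩

/-! ### The filtration by length and weight -/

variable {I : Type*} [LinearOrder I] {h : ℂ}

/-- The generator of `H_I` attached to a symbol. -/
def gen (h : ℂ) : HGen I → HAlg I h
  | .x i => x h i
  | .y i => y h i

/-- The product in `H_I` of a word in the generators. -/
def word (h : ℂ) (u : List (HGen I)) : HAlg I h := (u.map (gen h)).prod

@[simp] theorem word_nil : word h ([] : List (HGen I)) = 1 := rfl

@[simp] theorem word_cons (g : HGen I) (u : List (HGen I)) :
    word h (g :: u) = gen h g * word h u := by simp [word]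

@[simp] theorem word_append (u v : List (HGen I)) :
    word h (u ++ v) = word h u * word h v := by simp [word]

variable (I h) in
/-- The span of the words of length at most `D` and weight at most `w`. -/
def fil (D : ℕ) (w : ℤ) : Submodule ℂ (HAlg I h) :=
  Submodule.span ℂ {a | ∃ u : List (HGen I), u.length ≤ D ∧ weight u ≤ w ∧ a = word h u}

theorem word_mem_fil {u : List (HGen I)} {D : ℕ} {w : ℤ} (hD : u.length ≤ D)
    (hw : weight u ≤ w) : word h u ∈ fil I h D w :=
  Submodule.subset_span ⟨u, hD, hw, rfl⟩

theorem fil_le {D : ℕ} {w : ℤ} {N : Submodule ℂ (HAlg I h)}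
    (hN : ∀ u : List (HGen I), u.length ≤ D → weight u ≤ w → word h u ∈ N) :
    fil I h D w ≤ N := by
  refine Submodule.span_le.2 ?_
  rintro _ ⟨u, hD, hw, rfl⟩
  exact hN u hD hw

theorem fil_mono {D D' : ℕ} {w w' : ℤ} (hD : D ≤ D') (hw : w ≤ w') :
    fil I h D w ≤ fil I h D' w' :=
  fil_le fun _ h1 h2 => word_mem_fil (h1.trans hD) (h2.trans hw)

theorem fil_le_fil_length {D : ℕ} {w : ℤ} : fil I h D w ≤ fil I h D D :=
  fil_le fun u h1 _ => word_mem_fil h1 ((weight_le_length u).trans (by exact_mod_cast h1))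

/-- This is why length is bounded along with weight: descent in the weight must terminate. -/
theorem fil_eq_bot {D : ℕ} {w : ℤ} (hw : w < -D) : fil I h D w = ⊥ :=
  eq_bot_iff.2 <| fil_le fun u h1 h2 => by
    have := neg_length_le_weight u
    omega

theorem mul_mem_fil {D D' D'' : ℕ} {w w' w'' : ℤ} {a b : HAlg I h} (ha : a ∈ fil I h D w)
    (hb : b ∈ fil I h D' w') (hD : D + D' ≤ D'') (hw : w + w' ≤ w'') :
    a * b ∈ fil I h D'' w'' := by
  have key := Submodule.mul_mem_mul ha hb
  rw [fil, fil, Submodule.span_mul_span] at key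
  refine Submodule.span_le.2 ?_ key
  rintro _ ⟨_, ⟨u, h1, h2, rfl⟩, _, ⟨v, h3, h4, rfl⟩, rfl⟩
  simpa using word_mem_fil (h := h) (u := u ++ v) (by simp; omega) (by simp; omega)

theorem exists_mem_fil (a : HAlg I h) : ∃ D : ℕ, a ∈ fil I h D D := by
  induction a using induction with
  | hx i =>
    exact ⟨1, by simpa [gen] using
      word_mem_fil (h := h) (u := [.x i]) le_rfl (by simp [genWeight])⟩
  | hy i =>
    exact ⟨1, by simpa [gen] using
      word_mem_fil (h := h) (u := [.y i]) le_rfl (by simp [genWeight])⟩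
  | hs c =>
    refine ⟨0, ?_⟩
    rw [Algebra.algebraMap_eq_smul_one]
    exact Submodule.smul_mem _ _ (word_mem_fil (u := []) le_rfl le_rfl)
  | ha a b h1 h2 =>
    obtain ⟨D, h1⟩ := h1
    obtain ⟨D', h2⟩ := h2
    exact ⟨D + D', add_mem (fil_mono (by omega) (by omega) h1) (fil_mono (by omega) (by omega) h2)⟩
  | hm a b h1 h2 =>
    obtain ⟨D, h1⟩ := h1
    obtain ⟨D', h2⟩ := h2
    exact ⟨D + D', mul_mem_fil h1 h2 le_rfl (by simp)⟩

theorem gen_mem_fil (g : HGen I) : gen h g ∈ fil I h 1 (genWeight g) := by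
  simpa using word_mem_fil (h := h) (u := [g]) le_rfl (by simp)

theorem gen_mul_gen_mem_fil (g k : HGen I) {w : ℤ} (hw : genWeight g + genWeight k ≤ w) :
    gen h g * gen h k ∈ fil I h 2 w :=
  mul_mem_fil (gen_mem_fil g) (gen_mem_fil k) le_rfl hw

/-! ### Commutativity to leading order -/

/-- Generators commute up to terms of lower weight. -/
theorem gen_mul_sub_mem_fil (g k : HGen I) :
    gen h g * gen h k - gen h k * gen h g ∈ fil I h 2 (genWeight g + genWeight k - 1) := by
  have hc := compat (I := I) h
  have hyy (i j : I) {w : ℤ} (hw : -2 ≤ w) : y h i * y h j ∈ fil I h 2 w :=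
    gen_mul_gen_mem_fil (.y i) (.y j) (by simpa [genWeight] using hw)
  have hxy (i j : I) {w : ℤ} (hw : 0 ≤ w) : x h i * y h j ∈ fil I h 2 w :=
    gen_mul_gen_mem_fil (.x i) (.y j) (by simpa [genWeight] using hw)
  have hyx (i j : I) {w : ℤ} (hw : 0 ≤ w) : y h i * x h j ∈ fil I h 2 w :=
    gen_mul_gen_mem_fil (.y i) (.x j) (by simpa [genWeight] using hw)
  have key_xx (i j : I) (hij : i < j) : x h j * x h i - x h i * x h j ∈ fil I h 2 1 := by
    rw [hc.xx_lt hij, show x h i * x h j - h • (x h i * y h j) + h • (y h i * x h j) +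
      h ^ 2 • (y h i * y h j) - x h i * x h j = h • (y h i * x h j) - h • (x h i * y h j) +
      h ^ 2 • (y h i * y h j) by abel]
    exact add_mem (sub_mem (Submodule.smul_mem _ _ (hyx _ _ (by norm_num)))
      (Submodule.smul_mem _ _ (hxy _ _ (by norm_num))))
      (Submodule.smul_mem _ _ (hyy _ _ (by norm_num)))
  have key_xy (i j : I) : x h i * y h j - y h j * x h i ∈ fil I h 2 (-1) := by
    rcases lt_trichotomy i j with hij | rfl | hij
    · rw [hc.yx_lt hij, sub_sub_cancel]
      exact Submodule.smul_mem _ _ (hyy _ _ (by norm_num))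
    · rw [hc.xy, add_sub_cancel_left]
      exact Submodule.smul_mem _ _ (hyy _ _ (by norm_num))
    · rw [hc.xy_lt hij, add_sub_cancel_left]
      exact Submodule.smul_mem _ _ (hyy _ _ (by norm_num))
  cases g with
  | x i =>
    cases k with
    | x j =>
      rcases lt_trichotomy i j with hij | rfl | hij
      · exact neg_sub (x h j * x h i) _ ▸ neg_mem (key_xx i j hij)
      · simp
      · exact key_xx j i hij
    | y j => exact key_xy i j
  | y i =>
    cases k with
    | x j => exact neg_sub (x h j * y h i) _ ▸ neg_mem (key_xy j i)
    | y j =>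
      rcases lt_trichotomy i j with hij | rfl | hij
      · simp [gen, hc.yy_lt hij]
      · simp
      · simp [gen, hc.yy_lt hij]

/-- Rearranging a word changes its value only by terms of lower weight. -/
theorem word_sub_word_mem_fil {u v : List (HGen I)} (p : u.Perm v) :
    word h u - word h v ∈ fil I h u.length (weight u - 1) := by
  induction p with
  | nil => simp
  | @cons g u v p ih =>
    rw [word_cons, word_cons, ← mul_sub]
    exact mul_mem_fil (gen_mem_fil g) ih (by simp; omega) (by simp [add_sub_assoc])
  | swap g k u =>
    simp only [word_cons, ← mul_assoc]
    rw [← sub_mul]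
    exact mul_mem_fil (gen_mul_sub_mem_fil k g) (word_mem_fil le_rfl le_rfl) (by simp; omega)
      (by simp; omega)
  | @trans u v w p q ih1 ih2 =>
    rw [← sub_add_sub_cancel _ (word h v)]
    rw [← weight_perm p, ← p.length_eq] at ih2
    exact add_mem ih1 ih2

/-! ### The operators on the filtration -/

theorem F_gen_mem_fil (g : HGen I) : F (gen h g) ∈ fil I h 1 (genWeight g - 2) := by
  cases g with
  | x i => simpa [gen, genWeight] using gen_mem_fil (h := h) (.y i)
  | y i => simp [gen]

theorem F_word_mem_fil (u : List (HGen I)) : F (word h u) ∈ fil I h u.length (weight u - 2) := by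
  induction u with
  | nil => simp
  | cons g u ih =>
    rw [word_cons, F_mul]
    exact add_mem
      (mul_mem_fil (F_gen_mem_fil g) (word_mem_fil le_rfl le_rfl) (by simp; omega)
        (by simp; omega))
      (mul_mem_fil (gen_mem_fil g) ih (by simp; omega) (by simp; omega))

theorem F_mem_fil {D : ℕ} {w : ℤ} {a : HAlg I h} (ha : a ∈ fil I h D w) :
    F a ∈ fil I h D (w - 2) := by
  have key : fil I h D w ≤ (fil I h D (w - 2)).comap F :=
    fil_le fun u h1 h2 => fil_mono h1 (by omega) (F_word_mem_fil u)
  exact key ha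

theorem expF_gen_sub_mem_fil (t : ℂ) (g : HGen I) :
    expF t (gen h g) - gen h g ∈ fil I h 1 (genWeight g - 2) := by
  rw [expF_eq_lift]
  cases g with
  | x i =>
    simpa [gen, genWeight] using Submodule.smul_mem _ t (gen_mem_fil (h := h) (.y i))
  | y i => simp [gen]

theorem mem_fil_of_sub_mem {D : ℕ} {w : ℤ} {a b : HAlg I h} (hb : b ∈ fil I h D w)
    (hab : a - b ∈ fil I h D (w - 2)) : a ∈ fil I h D w := by
  simpa using add_mem (fil_mono le_rfl (by omega) hab) hb

/-- Since $e^{tF}$ is multiplicative, the estimate on generators propagates. It makes the twists in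
the Leibniz rules for `E` and `H` invisible to leading order. -/
theorem expF_word_sub_mem_fil (t : ℂ) (u : List (HGen I)) :
    expF t (word h u) - word h u ∈ fil I h u.length (weight u - 2) := by
  induction u with
  | nil => simp [expF_eq_lift]
  | cons g u ih =>
    have e : expF t (word h (g :: u)) - word h (g :: u) =
        (expF t (gen h g) - gen h g) * expF t (word h u) +
          gen h g * (expF t (word h u) - word h u) := by
      rw [word_cons, expF_mul, sub_mul, mul_sub]
      abel
    rw [e]
    exact add_mem
      (mul_mem_fil (expF_gen_sub_mem_fil t g)
        (mem_fil_of_sub_mem (word_mem_fil le_rfl le_rfl) ih) (by simp; omega) (by simp; omega))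
      (mul_mem_fil (gen_mem_fil g) ih (by simp; omega) (by simp; omega))

theorem expF_gen_mem_fil (t : ℂ) (g : HGen I) : expF t (gen h g) ∈ fil I h 1 (genWeight g) :=
  mem_fil_of_sub_mem (gen_mem_fil g) (expF_gen_sub_mem_fil t g)

theorem expF_word_mem_fil (t : ℂ) (u : List (HGen I)) :
    expF t (word h u) ∈ fil I h u.length (weight u) :=
  mem_fil_of_sub_mem (word_mem_fil le_rfl le_rfl) (expF_word_sub_mem_fil t u)

theorem E_gen_mem_fil (g : HGen I) : E (gen h g) ∈ fil I h 1 (genWeight g + 2) := by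
  cases g with
  | x i => simp [gen]
  | y i => simpa [gen, genWeight] using gen_mem_fil (h := h) (.x i)

theorem E_word_mem_fil (u : List (HGen I)) : E (word h u) ∈ fil I h u.length (weight u + 2) := by
  induction u with
  | nil => simp
  | cons g u ih =>
    rw [word_cons, E_mul]
    exact add_mem
      (mul_mem_fil (E_gen_mem_fil g) (expF_word_mem_fil _ u) (by simp; omega) (by simp; omega))
      (mul_mem_fil (expF_gen_mem_fil _ g) ih (by simp; omega) (by simp; omega))

theorem E_mem_fil {D : ℕ} {w : ℤ} {a : HAlg I h} (ha : a ∈ fil I h D w) :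
    E a ∈ fil I h D (w + 2) := by
  have key : fil I h D w ≤ (fil I h D (w + 2)).comap E :=
    fil_le fun u h1 h2 => fil_mono h1 (by omega) (E_word_mem_fil u)
  exact key ha

theorem H_gen (g : HGen I) : H (gen h g) = (genWeight g : ℂ) • gen h g := by
  cases g with
  | x i => simp [gen, genWeight]
  | y i =>
    simp only [gen, genWeight, H_y, Int.cast_neg, Int.cast_one]
    exact (neg_one_smul ℂ (y h i)).symm

theorem H_word_sub_mem_fil (u : List (HGen I)) :
    H (word h u) - (weight u : ℂ) • word h u ∈ fil I h u.length (weight u - 2) := by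
  induction u with
  | nil => simp
  | cons g u ih =>
    have hH : H (word h u) ∈ fil I h u.length (weight u) :=
      mem_fil_of_sub_mem (Submodule.smul_mem _ _ (word_mem_fil le_rfl le_rfl)) ih
    -- The first two terms measure the twists by $e^{\mp hF}$, each of which costs two units of
    -- weight; the third is the inductive error.
    have e : H (word h (g :: u)) - (weight (g :: u) : ℂ) • word h (g :: u) =
        (genWeight g : ℂ) • (gen h g * (expF (-h) (word h u) - word h u)) +
        (expF h (gen h g) - gen h g) * H (word h u) +
        gen h g * (H (word h u) - (weight u : ℂ) • word h u) := by
      rw [word_cons, H_mul, H_gen, weight_cons]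
      push_cast
      simp only [mul_sub, sub_mul, smul_mul_assoc, mul_smul_comm]
      module
    rw [e]
    refine add_mem (add_mem (Submodule.smul_mem _ _ ?_) ?_) ?_
    · exact mul_mem_fil (gen_mem_fil g) (expF_word_sub_mem_fil _ u) (by simp; omega)
        (by simp; omega)
    · exact mul_mem_fil (expF_gen_sub_mem_fil _ g) hH (by simp; omega) (by simp; omega)
    · exact mul_mem_fil (gen_mem_fil g) ih (by simp; omega) (by simp; omega)

/-- On the graded piece of weight `w`, the operator `H` is the scalar `w`. -/
theorem H_sub_mem_fil {D : ℕ} {w : ℤ} {a : HAlg I h} (ha : a ∈ fil I h D w) :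
    H a - (w : ℂ) • a ∈ fil I h D (w - 1) := by
  have key : fil I h D w ≤ (fil I h D (w - 1)).comap
      (H - (w : ℂ) • LinearMap.id : HAlg I h →ₗ[ℂ] HAlg I h) := by
    refine fil_le fun u h1 h2 => ?_
    have hu := H_word_sub_mem_fil (h := h) u
    change H (word h u) - (w : ℂ) • word h u ∈ fil I h D (w - 1)
    -- Words of weight exactly `w` leave an error two lower; words of smaller weight already lie in
    -- the target, which is why only `w - 1` can be claimed.
    rcases h2.eq_or_lt with rfl | h2
    · exact fil_mono h1 (by omega) hu
    · have hm : word h u ∈ fil I h D (w - 1) := word_mem_fil h1 (by omega)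
      have := add_mem (fil_mono h1 (by omega : weight u - 2 ≤ w - 1) hu)
        (Submodule.smul_mem _ (weight u : ℂ) hm)
      rw [sub_add_cancel] at this
      exact sub_mem this (Submodule.smul_mem _ (w : ℂ) hm)
  exact key ha

/-! ### Elements killed by `H` are concentrated in weight zero -/

theorem mem_fil_pred_of_H_eq_zero {D : ℕ} {w : ℤ} {a : HAlg I h} (ha : a ∈ fil I h D w)
    (hH : H a = 0) (hw : w ≠ 0) : a ∈ fil I h D (w - 1) := by
  have key := H_sub_mem_fil ha
  rw [hH, zero_sub] at key
  exact (Submodule.smul_mem_iff _ (by exact_mod_cast hw)).1 (neg_mem_iff.1 key)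

theorem mem_fil_zero_of_H_eq_zero {D : ℕ} {a : HAlg I h} (hH : H a = 0) (n : ℕ)
    (ha : a ∈ fil I h D n) : a ∈ fil I h D 0 := by
  induction n with
  | zero => exact ha
  | succ n ih =>
    exact ih (by simpa using mem_fil_pred_of_H_eq_zero ha hH (by omega))

theorem eq_zero_of_H_eq_zero {D : ℕ} {a : HAlg I h} (hH : H a = 0)
    (ha : a ∈ fil I h D (-1)) : a = 0 := by
  have key (n : ℕ) : a ∈ fil I h D (-1 - n) := by
    induction n with
    | zero => simpa using ha
    | succ n ih =>
      have := mem_fil_pred_of_H_eq_zero ih hH (by omega)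
      rwa [show (-1 - n - 1 : ℤ) = -1 - (n + 1 : ℕ) by push_cast; ring] at this
  -- The descent starts below zero, so the scalar never vanishes and it can run past the least
  -- weight `-D`.
  simpa [fil_eq_bot (I := I) (h := h) (show (-1 - D : ℤ) < -D by omega)] using key D

/-! ### Highest weight argument for `E` and `F` -/

theorem E_pow_mem_fil {D : ℕ} {w : ℤ} {a : HAlg I h} (ha : a ∈ fil I h D w) (n : ℕ) :
    (E ^ n) a ∈ fil I h D (w + 2 * n) := by
  induction n with
  | zero => simpa using ha
  | succ n ih =>
    rw [pow_succ', Module.End.mul_apply]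
    exact fil_mono le_rfl (by push_cast; omega) (E_mem_fil ih)

/-- The commutator of `Eⁿ` and `F` on the graded piece of weight `2`. -/
theorem E_pow_F_sub_mem_fil {D : ℕ} {a : HAlg I h} (ha : a ∈ fil I h D 2) (n : ℕ) :
    (E ^ n) (F a) - F ((E ^ n) a) - ((n : ℂ) * (n + 1)) • (E ^ (n - 1)) a ∈
      fil I h D (2 * n - 1) := by
  induction n with
  -- The truncated exponent `n - 1` is harmless here, because its coefficient is zero.
  | zero => simp
  | succ n ih =>
    have h1 : E ((E ^ n) (F a) - F ((E ^ n) a) - ((n : ℂ) * (n + 1)) • (E ^ (n - 1)) a) ∈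
        fil I h D (2 * (n + 1 : ℕ) - 1) :=
      fil_mono le_rfl (by push_cast; omega) (E_mem_fil ih)
    have h2 : H ((E ^ n) a) - (((2 + 2 * n : ℤ)) : ℂ) • (E ^ n) a ∈
        fil I h D (2 * (n + 1 : ℕ) - 1) :=
      fil_mono le_rfl (by push_cast; omega) (H_sub_mem_fil (E_pow_mem_fil ha n))
    have h3 : ((n : ℂ) * (n + 1)) • E ((E ^ (n - 1)) a) = ((n : ℂ) * (n + 1)) • (E ^ n) a := by
      cases n with
      | zero => simp
      | succ n => rw [pow_succ' E n]; rfl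
    -- $[E^{n+1},F]=E[E^n,F]+HE^n$, and $E^na$ has weight $2+2n$; the scalars add up as
    -- $n(n+1)+(2n+2)=(n+1)(n+2)$.
    convert add_mem h1 h2 using 1
    rw [← E_F_sub, map_sub, map_sub, map_smul, h3, pow_succ', Module.End.mul_apply,
      Module.End.mul_apply, Nat.add_sub_cancel]
    push_cast
    module

/-- On the graded piece of weight `2`, the operator `EF` is injective. -/
theorem mem_fil_one_of_E_F_mem {D : ℕ} {a : HAlg I h} (ha : a ∈ fil I h D 2)
    (hEF : E (F a) ∈ fil I h D 1) : a ∈ fil I h D 1 := by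
  -- The hypothesis says that $E^na$ vanishes in its graded piece, of weight $2+2n$. The commutator
  -- formula with its nonzero scalar passes this from $n+1$ down to $n$.
  have key (n : ℕ) : (E ^ n) a ∈ fil I h D (1 + 2 * n) → a ∈ fil I h D 1 := by
    induction n with
    | zero => simp
    | succ n ih =>
      intro hn
      refine ih ?_
      have h1 := E_pow_F_sub_mem_fil ha (n + 1)
      have h2 : (E ^ (n + 1)) (F a) ∈ fil I h D (1 + 2 * n) := by
        rw [pow_succ, Module.End.mul_apply]
        exact E_pow_mem_fil hEF n
      have h3 : F ((E ^ (n + 1)) a) ∈ fil I h D (1 + 2 * n) :=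
        fil_mono le_rfl (by push_cast; omega) (F_mem_fil hn)
      have h4 := sub_mem (sub_mem h2 h3) (fil_mono le_rfl
        (by push_cast; omega : (2 * (n + 1 : ℕ) - 1 : ℤ) ≤ 1 + 2 * n) h1)
      rw [sub_sub_cancel, Nat.add_sub_cancel] at h4
      refine (Submodule.smul_mem_iff _ ?_).1 h4
      norm_cast
  -- $E^Da$ meets the condition for free: weights never exceed the length bound `D`, and `D ≤ 1 + 2
  -- * D`.
  exact key D (fil_mono le_rfl (by omega) (fil_le_fil_length (E_pow_mem_fil ha D)))

/-! ### Invariance of the bracket symbols -/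

theorem F_bracket (i j : I) : F (bracket h i j) = 0 := by
  simp [bracket, F_mul]

theorem bracket_mem_invariants (i j : I) : bracket h i j ∈ invariants I h := by
  refine ⟨?_, F_bracket i j, ?_⟩
  · simp only [bracket, map_sub, map_smul, E_mul, E_x, E_y, expF_eq_lift, lift_x, lift_y]
    simp only [mul_add, add_mul, smul_mul_assoc, mul_smul_comm, zero_mul, mul_zero]
    module
  · have hy (k : I) : H (y h k) = (-1 : ℂ) • y h k := by
      simpa [gen, genWeight] using H_gen (h := h) (.y k)
    simp only [bracket, map_sub, map_smul, H_mul, H_x, hy, expF_eq_lift, lift_x, lift_y]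
    simp only [mul_add, add_mul, smul_mul_assoc, mul_smul_comm]
    module

theorem bracketAlgebra_le_invariants : bracketAlgebra I h ≤ invariants I h := by
  refine Algebra.adjoin_le ?_
  rintro _ ⟨i, j, rfl⟩
  exact bracket_mem_invariants i j

theorem bracket_mem_bracketAlgebra (i j : I) : bracket h i j ∈ bracketAlgebra I h :=
  Algebra.subset_adjoin ⟨i, j, rfl⟩

/-! ### Straightening words of weight zero -/

variable (I h) in
/-- The sum of the bracket algebra, the image under `F` of the words of weight at most `2`, and
the words of negative weight. -/
def straight (D : ℕ) : Submodule ℂ (HAlg I h) :=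
  Subalgebra.toSubmodule (bracketAlgebra I h) ⊔ (fil I h D 2).map F ⊔ fil I h D (-1)

theorem bracketAlgebra_le_straight (D : ℕ) :
    Subalgebra.toSubmodule (bracketAlgebra I h) ≤ straight I h D :=
  le_sup_left.trans le_sup_left

theorem map_F_le_straight (D : ℕ) : (fil I h D 2).map F ≤ straight I h D :=
  le_sup_right.trans le_sup_left

theorem fil_le_straight {D D' : ℕ} {w : ℤ} (hD : D ≤ D') (hw : w ≤ -1) :
    fil I h D w ≤ straight I h D' :=
  (fil_mono hD hw).trans le_sup_right

theorem bracket_mem_fil (i j : I) : bracket h i j ∈ fil I h 2 0 :=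
  sub_mem (sub_mem (gen_mul_gen_mem_fil (.x i) (.y j) (by simp [genWeight]))
    (gen_mul_gen_mem_fil (.y i) (.x j) (by simp [genWeight])))
    (Submodule.smul_mem _ _ (gen_mul_gen_mem_fil (.y i) (.y j) (by simp [genWeight])))

/-- Each summand is stable: brackets lie in $S_I$, they commute with applying `F` because `F` is a
derivation killing them, and they have weight at most 0. -/
theorem bracket_mul_mem_straight (i j : I) {D D' : ℕ} (hD : 2 + D ≤ D') {a : HAlg I h}
    (ha : a ∈ straight I h D) : bracket h i j * a ∈ straight I h D' := by
  obtain ⟨b, hb, c, hc, rfl⟩ := Submodule.mem_sup.1 ha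
  obtain ⟨s, hs, _, ⟨d, hd, rfl⟩, rfl⟩ := Submodule.mem_sup.1 hb
  rw [mul_add, mul_add]
  refine add_mem (add_mem (bracketAlgebra_le_straight _ ?_) (map_F_le_straight _ ?_))
    (fil_le_straight le_rfl le_rfl ?_)
  · exact (bracketAlgebra I h).mul_mem (bracket_mem_bracketAlgebra i j) hs
  · exact ⟨bracket h i j * d, mul_mem_fil (bracket_mem_fil i j) hd hD (by norm_num),
      by simp [F_mul, F_bracket]⟩
  · exact mul_mem_fil (bracket_mem_fil i j) hc hD (by norm_num)

theorem word_sub_word_mem_straight {u v : List (HGen I)} (p : u.Perm v) (hu : weight u = 0)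
    {D : ℕ} (hD : u.length ≤ D) : word h u - word h v ∈ straight I h D :=
  fil_le_straight hD (by omega) (word_sub_word_mem_fil p)

/-- Exchanging the letters of an `x`-`y` pair, given that shorter words straighten. -/
theorem exchange_mem_straight (i j : I) {u : List (HGen I)} (hu : weight u = 0)
    {D : ℕ} (hD : 2 + u.length ≤ D) (ih : word h u ∈ straight I h u.length) :
    word h (.x i :: .y j :: u) - word h (.y i :: .x j :: u) ∈ straight I h D := by
  -- The correction term $h\,y_iy_ju$ has weight $-2$ and is absorbed by the negative part.
  have e : word h (.x i :: .y j :: u) - word h (.y i :: .x j :: u) =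
      bracket h i j * word h u + h • (word h (.y i :: .y j :: u)) := by
    simp only [word_cons, gen, bracket, sub_mul, smul_mul_assoc, mul_assoc]
    abel
  rw [e]
  exact add_mem (bracket_mul_mem_straight i j hD ih) (Submodule.smul_mem _ _
    (fil_le_straight le_rfl le_rfl (word_mem_fil (by simp; omega) (by simp [genWeight, hu]))))

theorem exists_perm_cons_of_map_perm {α β : Type*} (f : α → β) {a : α} {u v : List α}
    (p : ((a :: u).map f).Perm (v.map f)) :
    ∃ b w, v.Perm (b :: w) ∧ f b = f a ∧ (u.map f).Perm (w.map f) := by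
  have ha : f a ∈ v.map f := p.subset (by simp)
  obtain ⟨b, hb, hab⟩ := List.mem_map.1 ha
  obtain ⟨s, t, rfl⟩ := List.append_of_mem hb
  refine ⟨b, s ++ t, List.perm_middle, hab, ?_⟩
  have q := p.trans (List.perm_middle.map f)
  rw [List.map_cons, List.map_cons, hab] at q
  exact q.cons_inv

/-- Given that shorter words straighten, the class of a word of weight zero depends only on the
indices of its letters. -/
theorem word_sub_word_mem_straight_of_map_perm {D : ℕ}
    (ih : ∀ u : List (HGen I), u.length < D → weight u = 0 →
      word h u ∈ straight I h u.length) (u : List (HGen I)) :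
    ∀ p v : List (HGen I), (p ++ u).length = D → (u.map genIndex).Perm (v.map genIndex) →
      weight (p ++ u) = 0 → weight (p ++ v) = 0 →
      word h (p ++ u) - word h (p ++ v) ∈ straight I h D := by
  have exch (p q : List (HGen I)) (i j : I) (hl : (p ++ .x i :: .y j :: q).length = D)
      (hw : weight (p ++ .x i :: .y j :: q) = 0) :
      word h (p ++ .x i :: .y j :: q) - word h (p ++ .y i :: .x j :: q) ∈ straight I h D := by
    have hl' : 2 + (p ++ q).length = D := by rw [← hl]; simp; omega
    have hw' : weight (p ++ q) = 0 := by simp [genWeight] at hw ⊢; omega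
    have pm (g k : HGen I) : (p ++ g :: k :: q).Perm (g :: k :: (p ++ q)) :=
      List.perm_middle.trans (List.perm_middle.cons _)
    have h1 := word_sub_word_mem_straight (h := h) (pm (.x i) (.y j)) hw hl.le
    have h2 := word_sub_word_mem_straight (h := h) (D := D) (pm (.y i) (.x j))
      (by simp [genWeight] at hw ⊢; omega) (by rw [← hl]; simp)
    have h3 := exchange_mem_straight i j hw' hl'.le (ih _ (by omega) hw')
    convert sub_mem (add_mem h1 h3) h2 using 1
    abel
  -- Letters of the two words that already agree accumulate in the common prefix `p`.
  induction u with
  | nil =>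
    intro p v _ hp _ _
    have : v = [] := by simpa using hp
    simp [this]
  | cons g u ihu =>
    intro p v hl hp hwu hwv
    obtain ⟨k, w, hv, hk, hw⟩ := exists_perm_cons_of_map_perm genIndex hp
    have hlen : u.length = w.length := by simpa using hw.length_eq
    have hpv : (p ++ v).Perm (p ++ k :: w) := hv.append_left p
    have hlv : (p ++ v).length = D := by
      rw [hpv.length_eq, ← hl]
      simp [hlen]
    have hwk : weight (p ++ k :: w) = 0 := by rw [← weight_perm hpv, hwv]
    have h1 := word_sub_word_mem_straight (h := h) hpv hwv hlv.le
    rw [← sub_sub_sub_cancel_right _ _ (word h (p ++ k :: w))]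
    refine sub_mem ?_ h1
    have same (w' : List (HGen I)) (hw' : (u.map genIndex).Perm (w'.map genIndex))
        (hz : weight (p ++ g :: w') = 0) :
        word h (p ++ g :: u) - word h (p ++ g :: w') ∈ straight I h D := by
      rw [List.append_cons p g u] at hl hwu ⊢
      rw [List.append_cons p g w'] at hz ⊢
      exact ihu _ _ hl hw' hwu hz
    cases g with
    | x i =>
      cases k with
      | x j =>
        obtain rfl : j = i := hk
        exact same w hw hwk
      | y j =>
        obtain rfl : j = i := hk
        have := neg_length_le_weight u
        -- Equal total weights make `w` two heavier than `u`, so it contains some `x`. Exchanging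
        -- $y_jx_c$ for $x_jy_c$ then makes the leading letters agree.
        obtain ⟨c, w', hc⟩ := exists_perm_x_cons (u := w)
          (by simp [genWeight] at hwk hwu; omega)
        have hwc := weight_perm hc
        have hlc := hc.length_eq
        have h2 := word_sub_word_mem_straight (h := h) (D := D)
          ((hc.cons (.y j)).append_left p) hwk (by rw [← hl]; simp [hlen])
        have hz : weight (p ++ .x j :: .y c :: w') = 0 := by
          simp [genWeight] at hwk hwc ⊢; omega
        have h3 := exch p w' j c (by rw [← hl]; simp at hlc ⊢; omega) hz
        have h4 := same (.y c :: w') (hw.trans (hc.map genIndex)) hz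
        convert sub_mem (add_mem h4 h3) h2 using 1
        abel
    | y i =>
      cases k with
      | y j =>
        obtain rfl : j = i := hk
        exact same w hw hwk
      | x j =>
        obtain rfl : j = i := hk
        have := weight_le_length u
        -- The mirror case: `w` is two lighter than `u`, so it contains some `y`.
        obtain ⟨c, w', hc⟩ := exists_perm_y_cons (u := w)
          (by simp [genWeight] at hwk hwu; omega)
        have hwc := weight_perm hc
        have hlc := hc.length_eq
        have h2 := word_sub_word_mem_straight (h := h) (D := D)
          ((hc.cons (.x j)).append_left p) hwk (by rw [← hl]; simp [hlen])
        have hz : weight (p ++ .x j :: .y c :: w') = 0 := by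
          simp [genWeight] at hwk hwc ⊢; omega
        have h3 := exch p w' j c (by rw [← hl]; simp at hlc ⊢; omega) hz
        have h4 := same (.x c :: w') (hw.trans (hc.map genIndex))
          (by simp [genWeight] at hz ⊢; omega)
        convert sub_mem (sub_mem h4 h3) h2 using 1
        abel

/-- The number of letters `x` in a word. -/
def countX {I : Type*} : List (HGen I) → ℕ
  | [] => 0
  | .x _ :: u => countX u + 1
  | .y _ :: u => countX u

/-- If the class of a word of weight zero depends only on the indices of its letters, then `F`
multiplies it by the number of letters `x` that it differentiates. -/
theorem word_mul_F_word_sub_mem {N : Submodule ℂ (HAlg I h)} {m : HAlg I h} {L : List I}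
    (hN : ∀ u : List (HGen I), weight u = 0 → (u.map genIndex).Perm L → word h u - m ∈ N)
    (u : List (HGen I)) : ∀ p : List (HGen I), weight (p ++ u) = 2 →
      ((p ++ u).map genIndex).Perm L →
      word h p * F (word h u) - (countX u : ℂ) • m ∈ N := by
  induction u with
  | nil => intro p _ _; simp [countX]
  | cons g u ih =>
    intro p hw hp
    have h1 := ih (p ++ [g]) (by rwa [← List.append_cons]) (by rwa [← List.append_cons])
    rw [word_append, word_cons, word_nil, mul_one, mul_assoc] at h1
    cases g with
    | y i =>
      simpa [gen, F_mul, countX] using h1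
    | x i =>
      -- The Leibniz term that differentiates this letter is a word of weight zero with the same
      -- indices, hence contributes one copy of `m`.
      have h2 := hN (p ++ .y i :: u) (by simp [genWeight] at hw ⊢; omega)
        (by simpa [genIndex] using hp)
      convert add_mem h1 h2 using 1
      simp only [word_append, word_cons, gen, F_mul, F_x, mul_add, countX, Nat.cast_add,
        Nat.cast_one]
      module

/-- Turn one `y` of `u` into an `x` and apply `F`. Every Leibniz term has the indices of `u` and
weight zero, so it is congruent to `u`. Thus a positive multiple of `u` is congruent to an image
under `F`, which is itself straight. -/
theorem word_mem_straight (n : ℕ) : ∀ u : List (HGen I), u.length = n → weight u = 0 →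
    word h u ∈ straight I h u.length := by
  induction n using Nat.strong_induction_on with
  | _ n ih =>
    intro u hn hu
    rcases List.eq_nil_or_concat' u with rfl | ⟨_, _, hne⟩
    · exact bracketAlgebra_le_straight _ (bracketAlgebra I h).one_mem
    have hpos : 0 < u.length := by simp [hne]
    clear hne
    obtain ⟨i, v, hv⟩ := exists_perm_y_cons (u := u) (by omega)
    have hlv := hv.length_eq
    have hwv := weight_perm hv
    have hN (w : List (HGen I)) (hw : weight w = 0)
        (hp : (w.map genIndex).Perm (u.map genIndex)) :
        word h w - word h u ∈ straight I h u.length := by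
      refine word_sub_word_mem_straight_of_map_perm (D := u.length)
        (fun t ht ht' => ih _ (hn ▸ ht) t rfl ht') w [] u ?_ hp hw hu
      simpa using hp.length_eq
    have key := word_mul_F_word_sub_mem hN (.x i :: v) []
      (by simp [genWeight] at hwv ⊢; omega) (hv.symm.map genIndex)
    rw [word_nil, one_mul] at key
    have hF : F (word h (.x i :: v)) ∈ straight I h u.length :=
      map_F_le_straight _ ⟨_, word_mem_fil (by rw [hlv]; simp)
        (by simp [genWeight] at hwv ⊢; omega), rfl⟩
    have := sub_mem hF key
    rw [sub_sub_cancel] at this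
    refine (Submodule.smul_mem_iff _ ?_).1 this
    -- The multiplicity is positive because the word being differentiated starts with $x_i$.
    exact Nat.cast_ne_zero.2 (Nat.succ_ne_zero (countX v))

theorem straight_mono {D D' : ℕ} (hD : D ≤ D') : straight I h D ≤ straight I h D' :=
  sup_le_sup (sup_le_sup le_rfl (Submodule.map_mono (fil_mono hD le_rfl))) (fil_mono hD le_rfl)

theorem fil_zero_le_straight (D : ℕ) : fil I h D 0 ≤ straight I h D :=
  fil_le fun u h1 h2 => by
    rcases h2.eq_or_lt with h2 | h2
    · exact straight_mono h1 (word_mem_straight _ u rfl h2)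
    · exact fil_le_straight h1 (by omega) (word_mem_fil le_rfl le_rfl)

/-! ### Conclusion -/

theorem invariants_le_bracketAlgebra : invariants I h ≤ bracketAlgebra I h := by
  intro v hv
  obtain ⟨D, hD⟩ := exists_mem_fil v
  have h0 := fil_zero_le_straight D (mem_fil_zero_of_H_eq_zero hv.2.2 D hD)
  obtain ⟨b, hb, c, hc, rfl⟩ := Submodule.mem_sup.1 h0
  obtain ⟨s, hs, _, ⟨d, hd, rfl⟩, rfl⟩ := Submodule.mem_sup.1 hb
  have hd' : d ∈ fil I h D 2 := hd
  have hs' : s ∈ invariants I h := bracketAlgebra_le_invariants hs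
  have hr : F d + c ∈ invariants I h := by
    have := (invariants I h).sub_mem hv hs'
    rwa [add_assoc, add_sub_cancel_left] at this
  have hEF : E (F d) = -E c := by
    rw [eq_neg_iff_add_eq_zero, ← map_add]
    exact hr.1
  -- `c` has weight at most $-1$, so $E(c)$ has weight at most 1, and injectivity of $EF$ applies.
  have hd1 : d ∈ fil I h D 1 := by
    refine mem_fil_one_of_E_F_mem hd' ?_
    rw [hEF]
    exact neg_mem (fil_mono le_rfl (by norm_num) (E_mem_fil hc))
  -- The remainder now lies in weight at most $-1$, where `H` has no kernel.
  have hz : F d + c = 0 := eq_zero_of_H_eq_zero hr.2.2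
    (add_mem (fil_mono le_rfl (by norm_num) (F_mem_fil hd1)) hc)
  rw [add_assoc, hz, add_zero]
  exact hs

end

end HAlg

theorem theorem4 {I : Type*} [LinearOrder I] (h : ℂ) (hh : h ≠ 0) :
    HAlg.invariants I h = HAlg.bracketAlgebra I h :=
  le_antisymm HAlg.invariants_le_bracketAlgebra HAlg.bracketAlgebra_le_invariants
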